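/- Let $n\ge 0$, $T>0$, let $H_0,H_1\in\mathfrak{su}(n)$ (traceless skew-Hermitian $n\times n$ complex matrices) and let $\rho_0,\theta$ be Hermitian $n\times n$ matrices. Let $\mathcal H=L^2([0,T],\mathbb R)$ with $(u,v)_{\mathcal H}=\int_0^T u(t)v(t)\,dt$. For every $u\in\mathcal H$ the equations $$\dot\rho(t)=[H_0+u(t)H_1,\rho(t)],\quad \rho(0)=\rho_0,\qquad\qquad \dot U(t)=(H_0+u(t)H_1)U(t),\quad U(0)=\mathrm{Id},\qquad t\in[0,T],$$ have unique (Carathéodory) solutions; put $\mathrm{End}_{\rho_0}(u):=\rho(T)$, which lies in $\mathcal O(\rho_0):=\{V\rho_0V^\dagger: V\in \mathrm{SU}(n)\}$. Let $J(\rho)=\mathrm{Re}\,\mathrm{tr}(\rho\theta)$ and $\mathcal J(u)=J(\mathrm{End}_{\rho_0}(u))$. Equip $T_\rho\mathcal O(\rho_0)=\{[\rho,\Omega]:\Omega\in\mathfrak{su}(n)\}$ with the scalar product $$\langle[\rho,\Omega_1],[\rho,\Omega_2]\rangle_\rho=\mathrm{tr}\big((\Omega_1^{\mathfrak p_\rho})^\dagger\,\Omega_2^{\mathfrak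 p_\rho}\big),$$ where $\Omega^{\mathfrak p_\rho}$ is the orthogonal projection of $\Omega$, for the scalar product $\mathrm{tr}(\Omega_1^\dagger\Omega_2)$ on $\mathfrak{su}(n)$, onto the orthogonal complement $\mathfrak p_\rho$ of $\{\Lambda\in\mathfrak{su}(n):[\rho,\Lambda]=0\}$. Let $\nabla J(\rho)\in T_\rho\mathcal O(\rho_0)$ be the gradient at $\rho$ of $J$ restricted to $\mathcal O(\rho_0)$, with respect to this metric. Then $\mathrm{End}_{\rho_0}$ is differentiable on $\mathcal H$ and, for every $u\in\mathcal H$, its differential at $u$ maps $\mathcal H$ into the tangent space at $\mathrm{End}_{\rho_0}(u)$. This differential has a unique adjoint $d\mathrm{End}_{\rho_0}^*(u):T_{\mathrm{End}_{\rho_0}(u)}\mathcal O(\rho_0)\to\mathcal H$ with respect to $\langle\cdot,\cdot\rangle_{\mathrm{End}_{\rho_0}(u)}$ and $(\cdot,\cdot)_{\mathcal H}$, the gradient $\nabla J(\mathrm{End}_{\rho_0}(u))$ exists and is unique, and the gradient of $\mathcal J$ at $u$ in $\mathcal H$ is the function given, for almost every $t\in[0,T]$, by $$\nabla\mathcal J(u)(t)=\big(d\mathrm{End}_{\rho_0}^*(u)\,\nabla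 J(\mathrm{End}_{\rho_0}(u))\big)(t)=-\mathrm{tr}\big([\rho_0,U(T)^\dagger\theta U(T)]^\dagger\,U(t)^\dagger H_1U(t)\big),$$ where $U$ is the propagator driven by $u$. (Since the commutator is skew-Hermitian, the right-hand side equals $+\mathrm{tr}([\rho_0,U(T)^\dagger\theta U(T)]\,U(t)^\dagger H_1U(t))$.) -/

import Mathlib

open MeasureTheory Matrix

-- The Hilbert-Schmidt norm on complex matrices.
attribute [local instance] Matrix.frobeniusNormedAddCommGroup
attribute [local instance] Matrix.frobeniusNormedSpace

namespace QuantumControl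

noncomputable section

/-- The real Hilbert space `L²([0,T], ℝ)` of admissible controls, with inner product
`(u, v) = ∫₀ᵀ u(t) v(t) dt`. -/
abbrev Control (T : ℝ) : Type :=
  Lp ℝ 2 (volume.restrict (Set.Icc (0 : ℝ) T))

/-- Traceless skew-Hermitian matrices, as a real vector space. -/
def su (n : ℕ) : Submodule ℝ (Matrix (Fin n) (Fin n) ℂ) :=
  skewAdjoint.submodule ℝ (Matrix (Fin n) (Fin n) ℂ) ⊓
    LinearMap.ker (Matrix.traceLinearMap (Fin n) ℝ ℂ)

/-- `ρ` is a (Carathéodory) solution on `[0,T]` of the controlled Liouville-von Neumann equation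
`ρ'(t) = [H₀ + u(t) H₁, ρ(t)]`, `ρ(0) = ρ₀`: a continuous solution of the integral equation. -/
def IsTrajectory {n : ℕ} {T : ℝ} (H₀ H₁ ρ₀ : Matrix (Fin n) (Fin n) ℂ) (u : Control T)
    (ρ : ℝ → Matrix (Fin n) (Fin n) ℂ) : Prop :=
  ContinuousOn ρ (Set.Icc 0 T) ∧
    ∀ t ∈ Set.Icc 0 T, ρ t = ρ₀ + ∫ s in (0 : ℝ)..t, ⁅H₀ + u s • H₁, ρ s⁆

/-- `U` is a (Carathéodory) solution on `[0,T]` of the propagator equation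
`U'(t) = (H₀ + u(t) H₁) U(t)`, `U(0) = Id`. -/
def IsPropagator {n : ℕ} {T : ℝ} (H₀ H₁ : Matrix (Fin n) (Fin n) ℂ) (u : Control T)
    (U : ℝ → Matrix (Fin n) (Fin n) ℂ) : Prop :=
  ContinuousOn U (Set.Icc 0 T) ∧
    ∀ t ∈ Set.Icc 0 T, U t = 1 + ∫ s in (0 : ℝ)..t, (H₀ + u s • H₁) * U s

open Classical in
/-- The end-point map `u ↦ ρ(T)`, where `ρ` is the solution of the Liouville-von Neumann equation
driven by `u`. -/
def endPoint {n : ℕ} {T : ℝ} (H₀ H₁ ρ₀ : Matrix (Fin n) (Fin n) ℂ) (u : Control T) :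
    Matrix (Fin n) (Fin n) ℂ :=
  if h : ∃ ρ, IsTrajectory H₀ H₁ ρ₀ u ρ then h.choose T else 0

/-- The unitary orbit `{U ρ₀ U† : U ∈ SU(n)}`. -/
def orbit {n : ℕ} (ρ₀ : Matrix (Fin n) (Fin n) ℂ) : Set (Matrix (Fin n) (Fin n) ℂ) :=
  {ρ | ∃ U ∈ Matrix.specialUnitaryGroup (Fin n) ℂ, ρ = U * ρ₀ * Uᴴ}

/-- The tangent space `{[ρ, Ω] : Ω ∈ su(n)}` at `ρ` of the unitary orbit through `ρ`. -/
def tangentSpace {n : ℕ} (ρ : Matrix (Fin n) (Fin n) ℂ) :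
    Submodule ℝ (Matrix (Fin n) (Fin n) ℂ) :=
  (su n).map (LinearMap.mulLeft ℝ ρ - LinearMap.mulRight ℝ ρ)

/-- `Ω` lies in `𝔭_ρ`, the orthogonal complement in `su(n)`, for the scalar product
`tr(Ω₁† Ω₂)`, of the stabilizer algebra `{Λ ∈ su(n) : [ρ, Λ] = 0}` of `ρ`. -/
def MemP {n : ℕ} (ρ Ω : Matrix (Fin n) (Fin n) ℂ) : Prop :=
  Ω ∈ su n ∧ ∀ Λ ∈ su n, ⁅ρ, Λ⁆ = 0 → (Ωᴴ * Λ).trace = 0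

open Classical in
/-- For a tangent vector `ξ` at `ρ`, the unique `Ω ∈ 𝔭_ρ` with `[ρ, Ω] = ξ`; in other words,
`Ω'^{𝔭_ρ}` for any `Ω' ∈ su(n)` with `[ρ, Ω'] = ξ`. -/
def lift {n : ℕ} (ρ ξ : Matrix (Fin n) (Fin n) ℂ) : Matrix (Fin n) (Fin n) ℂ :=
  if h : ∃ Ω, MemP ρ Ω ∧ ⁅ρ, Ω⁆ = ξ then h.choose else 0

/-- The invariant Riemannian metric of the unitary orbit, for tangent vectors at `ρ`:
`⟨[ρ, Ω₁], [ρ, Ω₂]⟩_ρ = tr((Ω₁^{𝔭_ρ})† Ω₂^{𝔭_ρ})` (a real number). -/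
def metric {n : ℕ} (ρ ξ η : Matrix (Fin n) (Fin n) ℂ) : ℝ :=
  ((lift ρ ξ)ᴴ * lift ρ η).trace.re

/-- The cost `J(ρ) = Re tr(ρ θ)`. -/
def cost {n : ℕ} (θ ρ : Matrix (Fin n) (Fin n) ℂ) : ℝ := (ρ * θ).trace.re

/-- `G` is the Riemannian gradient at `ρ` of `J` restricted to the unitary orbit through `ρ`:
`G` is tangent and `dJ(ρ) η = ⟨G, η⟩_ρ` for all tangent `η`. -/
def IsOrbitGradient {n : ℕ} (θ ρ : Matrix (Fin n) (Fin n) ℂ) (G : tangentSpace ρ) : Prop :=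
  ∀ η ∈ tangentSpace ρ, fderiv ℝ (cost θ) ρ η = metric ρ G η

/-- `A` is the adjoint of the differential at `u` of the end-point map, with respect to the
Riemannian metric at the end-point and the inner product of `L²([0,T], ℝ)`. -/
def IsAdjointDiff {n : ℕ} {T : ℝ} (H₀ H₁ ρ₀ : Matrix (Fin n) (Fin n) ℂ) (u : Control T)
    (A : tangentSpace (endPoint H₀ H₁ ρ₀ u) →ₗ[ℝ] Control T) : Prop :=
  ∀ (z : tangentSpace (endPoint H₀ H₁ ρ₀ u)) (v : Control T),
    metric (endPoint H₀ H₁ ρ₀ u) z (fderiv ℝ (endPoint H₀ H₁ ρ₀) u v) = inner ℝ (A z) v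

end

end QuantumControl

open QuantumControl

/-!
The end-point map is the value at `T` of the solution of a linear Volterra equation
`(1 - K_a) x = x₀`, where `K_a` depends linearly and boundedly on the `L²` coefficient `a`. The
operator `K_a` is quasi-nilpotent, so `1 - K_a` is invertible, and differentiability in `a` is
that of inversion in the Banach algebra of bounded operators.

For skew-Hermitian generators the propagator `U` is unitary and conjugating the linearized equation
by it (variation of constants) integrates it: with `Ω = ∫₀ᵀ v(s) U(s)† H₁ U(s) ds`, the differential
is `dEnd(u) v = U(T) ⁅Ω, ρ₀⁆ U(T)†`. It is tangent to the orbit because `Ω ∈ su(n)`.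
The gradient of `J` on the orbit is the double bracket `⁅ρ, ⁅ρ, θ⁆⁆`, as `⁅ρ, θ⁆` is orthogonal to
everything that commutes with `ρ`. Pairing `∇J` with the differential and moving `U(T)` onto `θ` by
cyclicity of the trace exhibits the gradient of `𝒥` as an `L²` representative of a continuous
function of `t`.
-/

namespace QuantumControl

noncomputable section

open Set

variable {E V W : Type*} [NormedAddCommGroup E] [NormedAddCommGroup V] [NormedAddCommGroup W]
  {T : ℝ}

/-- Time-dependent coefficients on `[0,T]` with values in `E`, square integrable in time; for
`E = ℝ` these are the controls. -/
abbrev Coefficient (E : Type*) [NormedAddCommGroup E] (T : ℝ) : Type _ :=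
  Lp E 2 (volume.restrict (Icc (0 : ℝ) T))

lemma Coefficient.integrableOn (a : Coefficient E T) : IntegrableOn a (Icc 0 T) :=
  (Lp.memLp a).integrable one_le_two

lemma intervalIntegrable_of_mem_Icc {f : ℝ → V} (hf : IntegrableOn f (Icc 0 T)) {t : ℝ}
    (ht : t ∈ Icc 0 T) : IntervalIntegrable f volume 0 t := by
  rw [intervalIntegrable_iff_integrableOn_Icc_of_le ht.1]
  exact hf.mono_set (Icc_subset_Icc_right ht.2)

lemma memLp_indicator_IccExtend (hT : 0 ≤ T) (t : ℝ) (x : C(Icc 0 T, V)) :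
    MemLp ((Iic t).indicator (IccExtend hT x)) 2 (volume.restrict (Icc 0 T)) := by
  refine MemLp.indicator measurableSet_Iic (.of_bound ?_ ‖x‖ (ae_of_all _ fun s => ?_))
  · exact x.continuous.Icc_extend'.aestronglyMeasurable
  · exact x.norm_coe_le_norm _

variable [NormedSpace ℝ E] [NormedSpace ℝ V] [NormedSpace ℝ W]

/-- `F` is absolutely continuous on `[0,T]` with derivative `f`, i.e. `F` is an indefinite integral
of the integrable function `f`. Carathéodory solutions of `F' = Φ(t, F)` are the `F` for which this
holds with `f = fun t => Φ(t, F t)`. -/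
structure IsPrimitive (T : ℝ) (F f : ℝ → V) : Prop where
  integrableOn : IntegrableOn f (Icc 0 T)
  eq_add_integral : ∀ t ∈ Icc 0 T, F t = F 0 + ∫ s in (0 : ℝ)..t, f s

lemma intervalIntegral_congr_ae_Icc {f g : ℝ → V} (h : f =ᵐ[volume.restrict (Icc 0 T)] g) {t : ℝ}
    (ht : t ∈ Icc 0 T) : ∫ s in (0 : ℝ)..t, f s = ∫ s in (0 : ℝ)..t, g s := by
  refine intervalIntegral.integral_congr_ae_restrict (ae_restrict_of_ae_restrict_of_subset ?_ h)
  rw [uIoc_of_le ht.1]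
  exact Ioc_subset_Icc_self.trans (Icc_subset_Icc_right ht.2)

lemma continuousOn_primitive_Icc {f : ℝ → V} (hf : IntegrableOn f (Icc 0 T)) :
    ContinuousOn (fun t => ∫ s in (0 : ℝ)..t, f s) (Icc 0 T) := by
  rcases le_or_gt 0 T with hT | hT
  · rw [← uIcc_of_le hT] at hf ⊢
    exact intervalIntegral.continuousOn_primitive_interval hf
  · simp [Icc_eq_empty_of_lt hT]

namespace IsPrimitive

variable {F G f g : ℝ → V}

lemma continuousOn (h : IsPrimitive T F f) : ContinuousOn F (Icc 0 T) :=
  (continuousOn_const.add (continuousOn_primitive_Icc h.integrableOn)).congr h.eq_add_integral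

lemma congr_ae (h : IsPrimitive T F f) (hfg : f =ᵐ[volume.restrict (Icc 0 T)] g) :
    IsPrimitive T F g :=
  ⟨h.integrableOn.congr hfg, fun t ht => by
    rw [h.eq_add_integral t ht, intervalIntegral_congr_ae_Icc hfg ht]⟩

lemma const (T : ℝ) (c : V) : IsPrimitive T (fun _ => c) (fun _ => 0) :=
  ⟨integrableOn_zero, by simp⟩

lemma of_integrableOn (hf : IntegrableOn f (Icc 0 T)) :
    IsPrimitive T (fun t => ∫ s in (0 : ℝ)..t, f s) f :=
  ⟨hf, by simp⟩

lemma congr (h : IsPrimitive T F f) (hFG : EqOn G F (Icc 0 T)) : IsPrimitive T G f :=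
  ⟨h.integrableOn, fun t ht => by
    rw [hFG ht, hFG ⟨le_rfl, ht.1.trans ht.2⟩, h.eq_add_integral t ht]⟩

lemma add (hF : IsPrimitive T F f) (hG : IsPrimitive T G g) :
    IsPrimitive T (fun t => F t + G t) (fun t => f t + g t) := by
  refine ⟨hF.integrableOn.add hG.integrableOn, fun t ht => ?_⟩
  rw [hF.eq_add_integral t ht, hG.eq_add_integral t ht, intervalIntegral.integral_add
    (intervalIntegrable_of_mem_Icc hF.integrableOn ht)
    (intervalIntegrable_of_mem_Icc hG.integrableOn ht)]
  abel

lemma clm_comp [CompleteSpace V] [CompleteSpace W] (L : V →L[ℝ] W) (h : IsPrimitive T F f) :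
    IsPrimitive T (fun t => L (F t)) (fun t => L (f t)) := by
  refine ⟨L.integrable_comp h.integrableOn, fun t ht => ?_⟩
  rw [h.eq_add_integral t ht, map_add, ← L.intervalIntegral_comp_comm
    (intervalIntegrable_of_mem_Icc h.integrableOn ht)]

end IsPrimitive

lemma integrableOn_bilin (L : E →L[ℝ] V →L[ℝ] W) {f : ℝ → E} {g : ℝ → V}
    (hf : IntegrableOn f (Icc 0 T)) (hg : ContinuousOn g (Icc 0 T)) :
    IntegrableOn (fun s => L (f s) (g s)) (Icc 0 T) := by
  obtain ⟨C, hC⟩ := isCompact_Icc.exists_bound_of_continuousOn hg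
  exact L.integrable_of_bilin_of_bdd_right C hf (hg.aestronglyMeasurable measurableSet_Icc)
    (ae_restrict_of_forall_mem measurableSet_Icc hC)

section Volterra

variable (hT : 0 ≤ T)

/-- The restriction to `[0,t]` of a continuous function on `[0,T]`, as an element of `L²`. -/
def cutoff (t : ℝ) : C(Icc 0 T, V) →ₗ[ℝ] Coefficient V T where
  toFun x := (memLp_indicator_IccExtend hT t x).toLp _
  map_add' x y := by
    rw [← MemLp.toLp_add]
    congr 1
    exact indicator_add (Iic t) (IccExtend hT x) (IccExtend hT y)
  map_smul' c x := by
    rw [RingHom.id_apply, ← MemLp.toLp_const_smul]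
    congr 1
    exact indicator_const_smul (Iic t) c (IccExtend hT x)

lemma setIntegral_Icc_indicator_Iic (f : ℝ → W) {t : ℝ} (ht : t ∈ Icc 0 T) :
    ∫ s in Icc 0 T, (Iic t).indicator f s = ∫ s in (0 : ℝ)..t, f s := by
  rw [setIntegral_indicator measurableSet_Iic, ← Ici_inter_Iic, inter_assoc, Iic_inter_Iic,
    inf_eq_right.2 ht.2, Ici_inter_Iic, integral_Icc_eq_integral_Ioc,
    intervalIntegral.integral_of_le ht.1]

lemma norm_cutoff_sq {t : ℝ} (ht : t ∈ Icc 0 T) (x : C(Icc 0 T, V)) :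
    ‖cutoff hT t x‖ ^ 2 = ∫ s in (0 : ℝ)..t, ‖IccExtend hT x s‖ ^ 2 := by
  have hsq : 0 ≤ ∫ s in Icc 0 T, ‖(Iic t).indicator (IccExtend hT x) s‖ ^ 2 :=
    integral_nonneg fun _ => by positivity
  have hind : ∀ s, ‖(Iic t).indicator (IccExtend hT x) s‖ ^ 2 =
      (Iic t).indicator (fun s => ‖IccExtend hT x s‖ ^ 2) s := fun s => by
    by_cases hs : s ∈ Iic t <;> simp [hs]
  change ‖(memLp_indicator_IccExtend hT t x).toLp _‖ ^ 2 = _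
  rw [Lp.norm_toLp, (memLp_indicator_IccExtend hT t x).eLpNorm_eq_integral_rpow_norm two_ne_zero
    ENNReal.ofNat_ne_top, ENNReal.toReal_ofReal (by positivity)]
  simp only [ENNReal.toReal_ofNat, Real.rpow_ofNat]
  rw [← one_div, ← Real.sqrt_eq_rpow, Real.sq_sqrt hsq]
  simp only [hind, setIntegral_Icc_indicator_Iic _ ht]

lemma norm_cutoff_le {t : ℝ} (ht : t ∈ Icc 0 T) (x : C(Icc 0 T, V)) :
    ‖cutoff hT t x‖ ≤ √T * ‖x‖ := by
  refine le_of_sq_le_sq ?_ (by positivity)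
  rw [norm_cutoff_sq hT ht, mul_pow, Real.sq_sqrt hT]
  have hbound : ∀ s ∈ uIoc 0 t, ‖‖IccExtend hT x s‖ ^ 2‖ ≤ ‖x‖ ^ 2 := fun s _ => by
    rw [Real.norm_of_nonneg (by positivity)]
    exact pow_le_pow_left₀ (norm_nonneg _) (x.norm_coe_le_norm _) 2
  calc _ ≤ ‖x‖ ^ 2 * |t - 0| :=
        (le_abs_self _).trans (intervalIntegral.norm_integral_le_of_norm_le_const hbound)
    _ ≤ T * ‖x‖ ^ 2 := by
        rw [sub_zero, abs_of_nonneg ht.1, mul_comm]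
        exact mul_le_mul_of_nonneg_right ht.2 (by positivity)

variable [CompleteSpace V] (L : E →L[ℝ] V →L[ℝ] V)

lemma lpPairing_cutoff (a : Coefficient E T) (x : C(Icc 0 T, V)) {t : ℝ} (ht : t ∈ Icc 0 T) :
    L.lpPairing (volume.restrict (Icc 0 T)) 2 2 a (cutoff hT t x) =
      ∫ s in (0 : ℝ)..t, L (a s) (IccExtend hT x s) := by
  rw [ContinuousLinearMap.lpPairing_eq_integral, ← setIntegral_Icc_indicator_Iic _ ht]
  refine integral_congr_ae ?_
  filter_upwards [(memLp_indicator_IccExtend hT t x).coeFn_toLp] with s hs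
  change L (a s) ((memLp_indicator_IccExtend hT t x).toLp _ s) = _
  rw [hs]
  by_cases hst : s ∈ Iic t <;> simp [hst]

lemma norm_integral_bilin_sq_le (a : Coefficient E T) (x : C(Icc 0 T, V)) {t : ℝ}
    (ht : t ∈ Icc 0 T) :
    ‖∫ s in (0 : ℝ)..t, L (a s) (IccExtend hT x s)‖ ^ 2 ≤
      ‖L.lpPairing (volume.restrict (Icc 0 T)) 2 2 a‖ ^ 2 *
        ∫ s in (0 : ℝ)..t, ‖IccExtend hT x s‖ ^ 2 := by
  rw [← lpPairing_cutoff hT L a x ht, ← norm_cutoff_sq hT ht, ← mul_pow]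
  gcongr
  exact ContinuousLinearMap.le_opNorm _ _

/-- The Volterra operators `x ↦ (t ↦ ∫₀ᵗ L(a(s), x(s)) ds)` on `C([0,T], V)`, as a continuous
linear function of the coefficient `a`. -/
def volterra : Coefficient E T →L[ℝ] C(Icc 0 T, V) →L[ℝ] C(Icc 0 T, V) :=
  LinearMap.mkContinuous₂
    (LinearMap.mk₂ ℝ
      (fun a x => ⟨fun t => L.lpPairing (volume.restrict (Icc 0 T)) 2 2 a (cutoff hT t x), by
        have hx : ContinuousOn (IccExtend hT x) (Icc 0 T) := x.continuous.Icc_extend'.continuousOn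
        refine (continuousOn_iff_continuous_domRestrict.1 <| continuousOn_primitive_Icc <|
          integrableOn_bilin L a.integrableOn hx).congr fun t => ?_
        exact (lpPairing_cutoff hT L a x t.2).symm⟩)
      (fun a b x => by ext t; simp)
      (fun c a x => by ext t; simp)
      (fun a x y => by ext t; simp)
      (fun c a x => by ext t; simp))
    (‖L.lpPairing (volume.restrict (Icc 0 T)) 2 2‖ * √T) fun a x => by
      rw [ContinuousMap.norm_le _ (by positivity)]
      intro t
      calc _ ≤ ‖L.lpPairing (volume.restrict (Icc 0 T)) 2 2‖ * ‖a‖ * ‖cutoff hT t x‖ :=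
            ContinuousLinearMap.le_opNorm₂ _ _ _
        _ ≤ ‖L.lpPairing (volume.restrict (Icc 0 T)) 2 2‖ * ‖a‖ * (√T * ‖x‖) := by
            gcongr
            exact norm_cutoff_le hT t.2 x
        _ = _ := by ring

lemma volterra_apply (a : Coefficient E T) (x : C(Icc 0 T, V)) (t : Icc 0 T) :
    volterra hT L a x t = ∫ s in (0 : ℝ)..t, L (a s) (IccExtend hT x s) :=
  lpPairing_cutoff hT L a x t.2

lemma norm_volterra_pow_apply_sq_le (a : Coefficient E T) (n : ℕ) (x : C(Icc 0 T, V))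
    (t : Icc 0 T) :
    ‖(volterra hT L a ^ n) x t‖ ^ 2 ≤
      (‖L.lpPairing (volume.restrict (Icc 0 T)) 2 2 a‖ ^ 2 * t) ^ n / n.factorial * ‖x‖ ^ 2 := by
  set C := ‖L.lpPairing (volume.restrict (Icc 0 T)) 2 2 a‖ ^ 2
  set K := volterra hT L a
  induction n generalizing t with
  | zero => simpa using pow_le_pow_left₀ (norm_nonneg _) (x.norm_coe_le_norm t) 2
  | succ n ih =>
    have hint : ∫ s in (0 : ℝ)..t, ‖IccExtend hT ((K ^ n) x) s‖ ^ 2 ≤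
        ∫ s in (0 : ℝ)..t, s ^ n * (C ^ n / n.factorial * ‖x‖ ^ 2) := by
      refine intervalIntegral.integral_mono_on t.2.1 ?_ ?_ fun s hs => ?_
      · exact (((K ^ n) x).continuous.Icc_extend'.norm.pow 2).intervalIntegrable _ _
      · exact (by fun_prop : Continuous _).intervalIntegrable _ _
      · have hsT : s ∈ Icc 0 T := ⟨hs.1, hs.2.trans t.2.2⟩
        rw [IccExtend_of_mem _ _ hsT]
        exact (ih ⟨s, hsT⟩).trans_eq (by rw [mul_pow]; ring)
    calc ‖(K ^ (n + 1)) x t‖ ^ 2 = ‖K ((K ^ n) x) t‖ ^ 2 := by rw [pow_succ' K]; rfl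
      _ ≤ C * ∫ s in (0 : ℝ)..t, ‖IccExtend hT ((K ^ n) x) s‖ ^ 2 := by
        rw [volterra_apply]
        exact norm_integral_bilin_sq_le hT L a _ t.2
      _ ≤ C * ∫ s in (0 : ℝ)..t, s ^ n * (C ^ n / n.factorial * ‖x‖ ^ 2) := by gcongr
      _ = _ := by
        rw [intervalIntegral.integral_mul_const, integral_pow, Nat.factorial_succ]
        push_cast
        field_simp
        ring

theorem isUnit_one_sub_volterra (a : Coefficient E T) : IsUnit (1 - volterra hT L a) := by
  set C := ‖L.lpPairing (volume.restrict (Icc 0 T)) 2 2 a‖ ^ 2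
  set K := volterra hT L a
  obtain ⟨n, hn⟩ := ((FloorSemiring.tendsto_pow_div_factorial_atTop (C * T)).eventually_lt_const
    one_pos).exists
  have hpos : 0 ≤ (C * T) ^ n / n.factorial := by positivity
  have hnorm : ‖K ^ n‖ ≤ √((C * T) ^ n / n.factorial) := by
    refine ContinuousLinearMap.opNorm_le_bound _ (by positivity) fun x => ?_
    rw [ContinuousMap.norm_le _ (by positivity)]
    intro t
    refine le_of_sq_le_sq ((norm_volterra_pow_apply_sq_le hT L a n x t).trans ?_) (by positivity)
    rw [mul_pow (√_), Real.sq_sqrt hpos]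
    have := t.2.1
    have := t.2.2
    gcongr
  have hunit : IsUnit (1 - K ^ n) := by
    refine isUnit_one_sub_of_norm_lt_one (x := K ^ n) (hnorm.trans_lt ?_)
    rwa [Real.sqrt_lt' one_pos, one_pow]
  rw [← mul_neg_geom_sum] at hunit
  refine ((Commute.isUnit_mul_iff ?_).1 hunit).1
  exact (Commute.one_left _).sub_left (Commute.sum_right _ _ _ fun i _ => Commute.self_pow K i)

/-- The solution of `x' = L(a, x)`, `x(0) = x₀` on `[0,T]`, obtained by inverting `1 - K` for the
Volterra operator `K` of the coefficient `a`. -/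
def solution (a : Coefficient E T) (x₀ : V) : C(Icc 0 T, V) :=
  Ring.inverse (1 - volterra hT L a) (.const _ x₀)

lemma isPrimitive_solution (a : Coefficient E T) (x₀ : V) :
    IsPrimitive T (IccExtend hT (solution hT L a x₀))
        (fun s => L (a s) (IccExtend hT (solution hT L a x₀) s)) ∧
      IccExtend hT (solution hT L a x₀) 0 = x₀ := by
  set x := solution hT L a x₀
  have hx : (1 - volterra hT L a) x = .const _ x₀ :=
    congr($(Ring.mul_inverse_cancel _ (isUnit_one_sub_volterra hT L a)) _)
  have hxt : ∀ t ∈ Icc 0 T,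
      IccExtend hT x t = x₀ + ∫ s in (0 : ℝ)..t, L (a s) (IccExtend hT x s) := fun t ht => by
    rw [IccExtend_of_mem _ _ ht, ← sub_eq_iff_eq_add, ← volterra_apply hT L a x ⟨t, ht⟩]
    exact congr($hx ⟨t, ht⟩)
  have hx0 : IccExtend hT x 0 = x₀ := by simpa using hxt 0 ⟨le_rfl, hT⟩
  refine ⟨⟨integrableOn_bilin L a.integrableOn ?_, by rwa [hx0]⟩, hx0⟩
  exact x.continuous.Icc_extend'.continuousOn

variable {L}

/-- The restriction to `[0,T]` of a function that is continuous there. -/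
def restrictIcc (f : ℝ → V) (hf : ContinuousOn f (Icc 0 T)) : C(Icc 0 T, V) :=
  ⟨(Icc 0 T).domRestrict f, continuousOn_iff_continuous_domRestrict.1 hf⟩

lemma volterra_restrictIcc_apply (a : Coefficient E T) {f : ℝ → V} (hf : ContinuousOn f (Icc 0 T))
    (t : Icc 0 T) :
    volterra hT L a (restrictIcc f hf) t = ∫ s in (0 : ℝ)..t, L (a s) (f s) := by
  rw [volterra_apply]
  refine intervalIntegral.integral_congr fun s hs => ?_
  rw [uIcc_of_le t.2.1] at hs
  simp only [IccExtend_of_mem hT _ (⟨hs.1, hs.2.trans t.2.2⟩ : s ∈ Icc 0 T)]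
  rfl

lemma inverse_one_sub_volterra_apply {a : Coefficient E T} {f g : ℝ → V}
    (hf : IsPrimitive T f (fun s => L (a s) (f s) + g s)) {y : C(Icc 0 T, V)}
    (hy : ∀ t : Icc 0 T, y t = f 0 + ∫ s in (0 : ℝ)..t, g s) :
    Ring.inverse (1 - volterra hT L a) y = restrictIcc f hf.continuousOn := by
  suffices h : (1 - volterra hT L a) (restrictIcc f hf.continuousOn) = y by
    rw [← h]
    exact congr($(Ring.inverse_mul_cancel _ (isUnit_one_sub_volterra hT L a)) _)
  ext t
  have hLf := integrableOn_bilin L a.integrableOn hf.continuousOn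
  have hg : IntegrableOn g (Icc 0 T) :=
    (hf.integrableOn.sub hLf).congr_fun (fun s _ => add_sub_cancel_left _ _) measurableSet_Icc
  change f t - volterra hT L a _ t = _
  rw [volterra_restrictIcc_apply, hf.eq_add_integral t t.2, intervalIntegral.integral_add
    (intervalIntegrable_of_mem_Icc hLf t.2) (intervalIntegrable_of_mem_Icc hg t.2), hy]
  abel

lemma solution_eq_restrictIcc {a : Coefficient E T} {f : ℝ → V}
    (hf : IsPrimitive T f (fun s => L (a s) (f s))) :
    solution hT L a (f 0) = restrictIcc f hf.continuousOn :=
  inverse_one_sub_volterra_apply hT (g := 0) (by simpa using hf) (by simp)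

theorem IsPrimitive.eqOn_of_linear {a : Coefficient E T} {f g : ℝ → V}
    (hf : IsPrimitive T f (fun s => L (a s) (f s)))
    (hg : IsPrimitive T g (fun s => L (a s) (g s))) (h0 : f 0 = g 0) : EqOn f g (Icc 0 T) := by
  intro t ht
  have hT : 0 ≤ T := ht.1.trans ht.2
  have h := (solution_eq_restrictIcc hT hf).symm.trans (h0 ▸ solution_eq_restrictIcc hT hg)
  exact congr($h ⟨t, ht⟩)

theorem hasFDerivAt_inverse_one_sub_apply {F X : Type*} [NormedAddCommGroup F] [NormedSpace ℝ F]
    [NormedAddCommGroup X] [NormedSpace ℝ X] [CompleteSpace X] (K : F →L[ℝ] X →L[ℝ] X) {u : F}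
    (hu : IsUnit (1 - K u)) (y : X) :
    HasFDerivAt (fun w => Ring.inverse (1 - K w) y)
      (Ring.inverse (1 - K u) ∘L K.flip (Ring.inverse (1 - K u) y)) u := by
  obtain ⟨R, hR⟩ := hu
  have hinv := hasFDerivAt_ringInverse (𝕜 := ℝ) (R := X →L[ℝ] X) R
  rw [hR] at hinv
  have hcomp := (HasFDerivAt.comp u hinv (K.hasFDerivAt.const_sub 1)).clm_apply
    (hasFDerivAt_const y u)
  refine hcomp.congr_fderiv ?_
  ext v
  simp [← hR]

theorem hasFDerivAt_solution (a : Coefficient E T) (x₀ : V) :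
    HasFDerivAt (fun b => solution hT L b x₀)
      (Ring.inverse (1 - volterra hT L a) ∘L (volterra hT L).flip (solution hT L a x₀)) a :=
  hasFDerivAt_inverse_one_sub_apply (volterra hT L) (isUnit_one_sub_volterra hT L a) _

end Volterra

section ProductRule

variable [CompleteSpace V] [CompleteSpace W] {X : Type*} [NormedAddCommGroup X] [NormedSpace ℝ X]

lemma integral_Ioc_prod_Ioc {t : ℝ} {h : ℝ × ℝ → X}
    (hh : Integrable h ((volume.restrict (Ioc 0 t)).prod (volume.restrict (Ioc 0 t)))) :
    ∫ p, h p ∂(volume.restrict (Ioc 0 t)).prod (volume.restrict (Ioc 0 t)) =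
      (∫ s in Ioc 0 t, ∫ r in Ioc 0 s, h (s, r)) + ∫ r in Ioc 0 t, ∫ s in Ioc 0 r, h (s, r) := by
  have hS : MeasurableSet {p : ℝ × ℝ | p.2 ≤ p.1} := measurableSet_le measurable_snd measurable_fst
  rw [← integral_add_compl hS hh, ← integral_indicator hS, ← integral_indicator hS.compl,
    integral_prod _ (hh.indicator hS), integral_prod_symm _ (hh.indicator hS.compl)]
  congr 1 <;> refine setIntegral_congr_fun measurableSet_Ioc fun s hs => ?_
  · have hslice : (fun r => {p : ℝ × ℝ | p.2 ≤ p.1}.indicator h (s, r)) =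
        (Iic s).indicator fun r => h (s, r) := by
      ext r
      simp [indicator_apply]
    simp only [hslice]
    rw [setIntegral_indicator measurableSet_Iic, Ioc_inter_Iic, min_eq_right hs.2]
  · have hslice : (fun r => {p : ℝ × ℝ | p.2 ≤ p.1}ᶜ.indicator h (r, s)) =
        (Iio s).indicator fun r => h (r, s) := by
      ext r
      simp [indicator_apply]
    have hinter : Ioc 0 t ∩ Iio s = Ioo 0 s := by
      ext r
      exact ⟨fun h => ⟨h.1.1, h.2⟩, fun h => ⟨⟨h.1, h.2.le.trans hs.2⟩, h.2⟩⟩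
    simp only [hslice]
    rw [setIntegral_indicator measurableSet_Iio, hinter, ← integral_Ioc_eq_integral_Ioo]

variable [CompleteSpace X] (B : V →L[ℝ] W →L[ℝ] X) {F f : ℝ → V} {G g : ℝ → W}

lemma bilin_integral_integral {t : ℝ} (hf : IntegrableOn f (Ioc 0 t))
    (hg : IntegrableOn g (Ioc 0 t)) :
    B (∫ s in Ioc 0 t, f s) (∫ r in Ioc 0 t, g r) =
      (∫ s in Ioc 0 t, B (f s) (∫ r in Ioc 0 s, g r)) +
        ∫ r in Ioc 0 t, B (∫ s in Ioc 0 r, f s) (g r) := by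
  have hleft : ∀ s ≤ t, ∀ w, ∫ r in Ioc 0 s, B (f r) w = B (∫ r in Ioc 0 s, f r) w :=
    fun s hs w => (B.flip w).integral_comp_comm (hf.mono_set (Ioc_subset_Ioc_right hs))
  have hright : ∀ s ≤ t, ∀ v, ∫ r in Ioc 0 s, B v (g r) = B v (∫ r in Ioc 0 s, g r) :=
    fun s hs v => (B v).integral_comp_comm (hg.mono_set (Ioc_subset_Ioc_right hs))
  have hprod : Integrable (fun p : ℝ × ℝ => B (f p.1) (g p.2))
      ((volume.restrict (Ioc 0 t)).prod (volume.restrict (Ioc 0 t))) :=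
    hf.op_fst_snd (op := fun v w => B v w) B.continuous₂ ⟨‖B‖, fun v w => B.le_opNorm₂ v w⟩ hg
  calc _ = ∫ s in Ioc 0 t, ∫ r in Ioc 0 t, B (f s) (g r) := by
        simp only [hright t le_rfl, hleft t le_rfl]
    _ = _ := (integral_prod _ hprod).symm
    _ = _ := integral_Ioc_prod_Ioc hprod
    _ = _ := by
        congr 1 <;> refine setIntegral_congr_fun measurableSet_Ioc fun s hs => ?_
        · exact hright s hs.2 (f s)
        · exact hleft s hs.2 (g s)

lemma isPrimitive_bilin_integral (hf : IntegrableOn f (Icc 0 T)) (hg : IntegrableOn g (Icc 0 T)) :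
    IsPrimitive T (fun t => B (∫ s in (0 : ℝ)..t, f s) (∫ r in (0 : ℝ)..t, g r))
      (fun t => B (f t) (∫ r in (0 : ℝ)..t, g r) + B (∫ s in (0 : ℝ)..t, f s) (g t)) := by
  have hl : IntegrableOn (fun t => B (f t) (∫ r in (0 : ℝ)..t, g r)) (Icc 0 T) :=
    integrableOn_bilin B hf (continuousOn_primitive_Icc hg)
  have hr : IntegrableOn (fun t => B (∫ s in (0 : ℝ)..t, f s) (g t)) (Icc 0 T) :=
    integrableOn_bilin B.flip hg (continuousOn_primitive_Icc hf)
  refine ⟨hl.add hr, fun t ht => ?_⟩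
  have hsub : Ioc 0 t ⊆ Icc 0 T := Ioc_subset_Icc_self.trans (Icc_subset_Icc_right ht.2)
  rw [intervalIntegral.integral_same, map_zero, _root_.zero_apply, zero_add,
    intervalIntegral.integral_add (intervalIntegrable_of_mem_Icc hl ht)
    (intervalIntegrable_of_mem_Icc hr ht)]
  simp only [intervalIntegral.integral_of_le ht.1]
  rw [bilin_integral_integral B (hf.mono_set hsub) (hg.mono_set hsub)]
  congr 1 <;> refine setIntegral_congr_fun measurableSet_Ioc fun s hs => ?_ <;>
    simp only [intervalIntegral.integral_of_le hs.1.le]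

theorem IsPrimitive.bilin (hF : IsPrimitive T F f) (hG : IsPrimitive T G g) :
    IsPrimitive T (fun t => B (F t) (G t)) (fun t => B (f t) (G t) + B (F t) (g t)) := by
  have hlin := ((of_integrableOn hG.integrableOn).clm_comp (B (F 0))).add
    ((of_integrableOn hF.integrableOn).clm_comp (B.flip (G 0)))
  have hsum := ((const T (B (F 0) (G 0))).add hlin).add
    (isPrimitive_bilin_integral B hF.integrableOn hG.integrableOn)
  refine (hsum.congr fun t ht => ?_).congr_ae <|
    ae_restrict_of_forall_mem measurableSet_Icc fun t ht => ?_
  all_goals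
    simp only [hF.eq_add_integral t ht, hG.eq_add_integral t ht, map_add,
      _root_.add_apply, ContinuousLinearMap.flip_apply]
    abel

end ProductRule

section Propagator

lemma mul_lie_mul_of_mul_eq_one {R : Type*} [Ring R] {v w : R} (hvw : v * w = 1) (b x : R) :
    v * ⁅w * b * v, x⁆ * w = ⁅b, v * x * w⁆ := by
  calc v * ⁅w * b * v, x⁆ * w = v * w * (b * (v * x * w)) - v * x * w * b * (v * w) := by
        rw [Ring.lie_def]
        noncomm_ring
    _ = ⁅b, v * x * w⁆ := by rw [hvw, one_mul, mul_one, Ring.lie_def]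

variable {𝔸 : Type*} [NormedRing 𝔸] [NormedAlgebra ℝ 𝔸]

/-- The commutator `⁅x, y⁆ = x * y - y * x` as a continuous bilinear map. -/
def commutator (𝔸 : Type*) [NormedRing 𝔸] [NormedAlgebra ℝ 𝔸] : 𝔸 →L[ℝ] 𝔸 →L[ℝ] 𝔸 :=
  .mul ℝ 𝔸 - (ContinuousLinearMap.mul ℝ 𝔸).flip

lemma commutator_apply (x y : 𝔸) : commutator 𝔸 x y = ⁅x, y⁆ := rfl

variable [CompleteSpace 𝔸] [StarRing 𝔸] [ContinuousStar 𝔸] [StarModule ℝ 𝔸]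

theorem IsPrimitive.conj_propagator {a U W w : ℝ → 𝔸}
    (ha : ∀ᵐ s ∂volume.restrict (Icc 0 T), star (a s) = -a s)
    (hU : IsPrimitive T U (fun s => a s * U s)) (hW : IsPrimitive T W w) :
    IsPrimitive T (fun t => U t * W t * star (U t))
      (fun t => ⁅a t, U t * W t * star (U t)⁆ + U t * w t * star (U t)) := by
  have hprod := (hU.bilin (.mul ℝ 𝔸) hW).bilin (.mul ℝ 𝔸)
    (hU.clm_comp (starL' ℝ : 𝔸 ≃L[ℝ] 𝔸).toContinuousLinearMap)
  refine hprod.congr_ae (ha.mono fun s hs => ?_)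
  change (a s * U s * W s + U s * w s) * star (U s) + U s * W s * star (a s * U s) = _
  simp only [star_mul, hs, Ring.lie_def]
  noncomm_ring

variable {a : Coefficient 𝔸 T} {U : ℝ → 𝔸}

theorem isPrimitive_conj_const (ha : ∀ᵐ s ∂volume.restrict (Icc 0 T), star (a s) = -a s)
    (hU : IsPrimitive T U (fun s => a s * U s)) (x₀ : 𝔸) :
    IsPrimitive T (fun t => U t * x₀ * star (U t))
      (fun t => commutator 𝔸 (a t) (U t * x₀ * star (U t))) := by
  simpa [commutator_apply] using IsPrimitive.conj_propagator ha hU (.const T x₀)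

theorem propagator_mul_star_self (ha : ∀ᵐ s ∂volume.restrict (Icc 0 T), star (a s) = -a s)
    (hU : IsPrimitive T U (fun s => a s * U s)) (hU0 : U 0 = 1) {t : ℝ} (ht : t ∈ Icc 0 T) :
    U t * star (U t) = 1 := by
  have hone : IsPrimitive T (fun _ => (1 : 𝔸)) (fun s => commutator 𝔸 (a s) 1) := by
    simpa [commutator_apply, Ring.lie_def] using IsPrimitive.const T (1 : 𝔸)
  simpa using (isPrimitive_conj_const ha hU 1).eqOn_of_linear hone (by simp [hU0]) ht

theorem inverse_one_sub_volterra_commutator (hT : 0 ≤ T)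
    (ha : ∀ᵐ s ∂volume.restrict (Icc 0 T), star (a s) = -a s)
    (hU : IsPrimitive T U (fun s => a s * U s)) (hU0 : U 0 = 1) (b : Coefficient 𝔸 T) (x₀ : 𝔸)
    (t : Icc 0 T) :
    Ring.inverse (1 - volterra hT (commutator 𝔸) a)
        (volterra hT (commutator 𝔸) b (solution hT (commutator 𝔸) a x₀)) t =
      U t * ⁅∫ s in (0 : ℝ)..t, star (U s) * b s * U s, x₀⁆ * star (U t) := by
  have hb : IntegrableOn (fun s => star (U s) * b s * U s) (Icc 0 T) :=
    integrableOn_bilin (.mul ℝ 𝔸) (integrableOn_bilin (ContinuousLinearMap.mul ℝ 𝔸).flip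
      b.integrableOn hU.continuousOn.star) hU.continuousOn
  have hW := (IsPrimitive.of_integrableOn hb).clm_comp ((commutator 𝔸).flip x₀)
  have hconj := (IsPrimitive.conj_propagator ha hU hW).congr_ae <|
    ae_restrict_of_forall_mem measurableSet_Icc fun s hs => congrArg _ <|
      mul_lie_mul_of_mul_eq_one (propagator_mul_star_self ha hU hU0 hs) (b s) x₀
  have hsol := solution_eq_restrictIcc hT (isPrimitive_conj_const ha hU x₀)
  simp only [hU0, star_one, one_mul, mul_one] at hsol
  have hinv := inverse_one_sub_volterra_apply hT (L := commutator 𝔸)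
    (y := volterra hT (commutator 𝔸) b (solution hT (commutator 𝔸) a x₀)) hconj fun s => by
      rw [hsol, volterra_restrictIcc_apply]
      simp [commutator_apply]
  exact congr($hinv t)

end Propagator

section Control

/-- The coefficient `t ↦ A + u(t) B` of a bilinear control system with drift `A` and control field
`B`, as an affine function of the control `u`. -/
def generator (A B : V) (u : Control T) : Coefficient V T :=
  Lp.const 2 _ A + (ContinuousLinearMap.toSpanSingleton ℝ B).compLpL 2 _ u

lemma coeFn_generator (A B : V) (u : Control T) :
    generator A B u =ᵐ[volume.restrict (Icc 0 T)] fun s => A + u s • B := by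
  filter_upwards [Lp.coeFn_add (Lp.const 2 (volume.restrict (Icc 0 T)) A)
      ((ContinuousLinearMap.toSpanSingleton ℝ B).compLpL 2 _ u), Lp.coeFn_const (p := 2)
      (μ := volume.restrict (Icc 0 T)) A,
    (ContinuousLinearMap.toSpanSingleton ℝ B).coeFn_compLpL u] with s hadd hconst hcomp
  rw [generator, hadd, Pi.add_apply, hconst, hcomp]
  rfl

lemma star_generator [StarAddMonoid V] [StarModule ℝ V] {A B : V} (hA : star A = -A)
    (hB : star B = -B) (u : Control T) :
    ∀ᵐ s ∂volume.restrict (Icc 0 T), star (generator A B u s) = -generator A B u s := by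
  filter_upwards [coeFn_generator A B u] with s hs
  rw [hs, star_add, star_smul, hA, hB, star_trivial, smul_neg, neg_add]

lemma hasFDerivAt_generator (A B : V) (u : Control T) :
    HasFDerivAt (generator A B) ((ContinuousLinearMap.toSpanSingleton ℝ B).compLpL 2 _) u :=
  (ContinuousLinearMap.hasFDerivAt _).const_add _

lemma isPrimitive_linear_iff (hT : 0 ≤ T) (L : E →L[ℝ] V →L[ℝ] V) (A B : E) (u : Control T)
    {f : ℝ → V} {x₀ : V} :
    IsPrimitive T f (fun s => L (generator A B u s) (f s)) ∧ f 0 = x₀ ↔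
      ContinuousOn f (Icc 0 T) ∧
        ∀ t ∈ Icc 0 T, f t = x₀ + ∫ s in (0 : ℝ)..t, L (A + u s • B) (f s) := by
  have hgen : (fun s => L (generator A B u s) (f s)) =ᵐ[volume.restrict (Icc 0 T)]
      fun s => L (A + u s • B) (f s) :=
    (coeFn_generator A B u).mono fun s hs => congr(L $hs (f s))
  constructor
  · rintro ⟨hf, rfl⟩
    exact ⟨hf.continuousOn, (hf.congr_ae hgen).eq_add_integral⟩
  · rintro ⟨hfc, hf⟩
    have h0 : f 0 = x₀ := by simpa using hf 0 ⟨le_rfl, hT⟩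
    refine ⟨IsPrimitive.congr_ae ⟨?_, by rwa [h0]⟩ hgen.symm, h0⟩
    exact (integrableOn_bilin L (generator A B u).integrableOn hfc).congr hgen

variable [CompleteSpace V]

lemma exists_isPrimitive_linear_forall_eqOn (hT : 0 ≤ T) (L : E →L[ℝ] V →L[ℝ] V)
    (a : Coefficient E T) (x₀ : V) :
    ∃ f, (IsPrimitive T f (fun s => L (a s) (f s)) ∧ f 0 = x₀) ∧
      ∀ g, IsPrimitive T g (fun s => L (a s) (g s)) ∧ g 0 = x₀ → EqOn g f (Icc 0 T) :=
  ⟨_, isPrimitive_solution hT L a x₀, fun _ hg => hg.1.eqOn_of_linear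
    (isPrimitive_solution hT L a x₀).1 (hg.2.trans (isPrimitive_solution hT L a x₀).2.symm)⟩

/-- The differential at the control `u` of the state at time `t` of the bilinear control system
`x' = L (A + u B) x`, `x(0) = x₀`. -/
def firstVariation (hT : 0 ≤ T) (L : E →L[ℝ] V →L[ℝ] V) (A B : E) (u : Control T) (x₀ : V)
    (t : Icc 0 T) : Control T →L[ℝ] V :=
  ContinuousMap.evalCLM ℝ t ∘L Ring.inverse (1 - volterra hT L (generator A B u)) ∘L
    (volterra hT L).flip (solution hT L (generator A B u) x₀) ∘L
      (ContinuousLinearMap.toSpanSingleton ℝ B).compLpL 2 _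

theorem hasFDerivAt_solution_generator (hT : 0 ≤ T) (L : E →L[ℝ] V →L[ℝ] V) (A B : E)
    (u : Control T) (x₀ : V) (t : Icc 0 T) :
    HasFDerivAt (fun w => solution hT L (generator A B w) x₀ t)
      (firstVariation hT L A B u x₀ t) u := by
  have hsol : HasFDerivAt (fun w => solution hT L (generator A B w) x₀) _ u :=
    (hasFDerivAt_solution hT _ x₀).comp u (hasFDerivAt_generator A B u)
  exact (ContinuousMap.evalCLM ℝ t : C(Icc 0 T, V) →L[ℝ] V).hasFDerivAt.comp u hsol

theorem firstVariation_commutator_apply {𝔸 : Type*} [NormedRing 𝔸] [NormedAlgebra ℝ 𝔸]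
    [CompleteSpace 𝔸] [StarRing 𝔸] [ContinuousStar 𝔸] [StarModule ℝ 𝔸] (hT : 0 ≤ T) {A B : 𝔸}
    (hA : star A = -A) (hB : star B = -B) {u : Control T} {U : ℝ → 𝔸}
    (hU : IsPrimitive T U (fun s => generator A B u s * U s)) (hU0 : U 0 = 1) (x₀ : 𝔸)
    (t : Icc 0 T) (v : Control T) :
    firstVariation hT (commutator 𝔸) A B u x₀ t v =
      U t * ⁅∫ s in (0 : ℝ)..t, v s • (star (U s) * B * U s), x₀⁆ * star (U t) := by
  have hint : ∫ s in (0 : ℝ)..t, star (U s) *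
      (ContinuousLinearMap.toSpanSingleton ℝ B).compLpL 2 _ v s * U s =
      ∫ s in (0 : ℝ)..t, v s • (star (U s) * B * U s) := by
    refine intervalIntegral_congr_ae_Icc ?_ t.2
    filter_upwards [(ContinuousLinearMap.toSpanSingleton ℝ B).coeFn_compLpL v] with s hs
    rw [hs, ContinuousLinearMap.toSpanSingleton_apply, mul_smul_comm, smul_mul_assoc]
  rw [← hint]
  exact inverse_one_sub_volterra_commutator hT (star_generator hA hB u) hU hU0 _ x₀ t

end Control

section OrbitGeometry

variable {n : ℕ} {ρ θ : Matrix (Fin n) (Fin n) ℂ}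

lemma mem_su_iff {A : Matrix (Fin n) (Fin n) ℂ} : A ∈ su n ↔ Aᴴ = -A ∧ A.trace = 0 := Iff.rfl

lemma mem_tangentSpace_iff {ξ : Matrix (Fin n) (Fin n) ℂ} :
    ξ ∈ tangentSpace ρ ↔ ∃ Ω ∈ su n, ⁅ρ, Ω⁆ = ξ := Iff.rfl

lemma lie_mem_tangentSpace {Ω : Matrix (Fin n) (Fin n) ℂ} (hΩ : Ω ∈ su n) :
    ⁅ρ, Ω⁆ ∈ tangentSpace ρ :=
  mem_tangentSpace_iff.2 ⟨Ω, hΩ, rfl⟩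

/-- The real Hilbert–Schmidt scalar product `Re tr(A† B)` of matrices. -/
def hilbertSchmidt (n : ℕ) : LinearMap.BilinForm ℝ (Matrix (Fin n) (Fin n) ℂ) :=
  LinearMap.mk₂ ℝ (fun A B => (Aᴴ * B).trace.re)
    (by intros; simp [add_mul]) (by intros; simp) (by intros; simp [mul_add]) (by intros; simp)

lemma hilbertSchmidt_apply (A B : Matrix (Fin n) (Fin n) ℂ) :
    hilbertSchmidt n A B = (Aᴴ * B).trace.re := rfl

lemma isSymm_hilbertSchmidt (n : ℕ) : (hilbertSchmidt n).IsSymm where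
  eq A B := by
    rw [hilbertSchmidt_apply, hilbertSchmidt_apply, ← Complex.conj_re,
      starRingEnd_apply, ← trace_conjTranspose, conjTranspose_mul, conjTranspose_conjTranspose]

lemma trace_mul_im_eq_zero {A B : Matrix (Fin n) (Fin n) ℂ} (hA : Aᴴ = -A) (hB : Bᴴ = -B) :
    (A * B).trace.im = 0 := by
  rw [← Complex.conj_eq_iff_im, starRingEnd_apply, ← trace_conjTranspose, conjTranspose_mul, hA, hB,
    neg_mul_neg, trace_mul_comm]

lemma trace_conjTranspose_mul_eq_zero_iff {A B : Matrix (Fin n) (Fin n) ℂ} (hA : Aᴴ = -A)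
    (hB : Bᴴ = -B) : (Aᴴ * B).trace = 0 ↔ hilbertSchmidt n A B = 0 := by
  have him : (Aᴴ * B).trace.im = 0 := trace_mul_im_eq_zero (by rw [hA, conjTranspose_neg, hA]) hB
  rw [Complex.ext_iff, hilbertSchmidt_apply, Complex.zero_re, Complex.zero_im, and_iff_left him]

lemma eq_zero_of_hilbertSchmidt_self {A : Matrix (Fin n) (Fin n) ℂ}
    (h : hilbertSchmidt n A A = 0) : A = 0 := by
  open scoped ComplexOrder in
  exact trace_conjTranspose_mul_self_eq_zero_iff.1 <|
    Complex.ext h (Complex.nonneg_iff.1 (posSemidef_conjTranspose_mul_self A).trace_nonneg).2.symm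

/-- The map `Ω ↦ ⁅ρ, Ω⁆` on `su(n)`, with kernel the stabilizer algebra of `ρ` and range the tangent
space at `ρ`. -/
def suBracket (ρ : Matrix (Fin n) (Fin n) ℂ) : su n →ₗ[ℝ] Matrix (Fin n) (Fin n) ℂ :=
  (LinearMap.mulLeft ℝ ρ - LinearMap.mulRight ℝ ρ).domRestrict (su n)

lemma range_suBracket (ρ : Matrix (Fin n) (Fin n) ℂ) :
    LinearMap.range (suBracket ρ) = tangentSpace ρ :=
  LinearMap.range_domRestrict _ _

/-- The space `𝔭_ρ`: the orthogonal complement in `su(n)` of the stabilizer algebra of `ρ`. -/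
def horizontal (ρ : Matrix (Fin n) (Fin n) ℂ) : Submodule ℝ (su n) :=
  ((hilbertSchmidt n).restrict (su n)).orthogonal (LinearMap.ker (suBracket ρ))

lemma memP_coe_iff {Ω : su n} : MemP ρ Ω ↔ Ω ∈ horizontal ρ := by
  rw [horizontal, LinearMap.BilinForm.mem_orthogonal_iff, MemP, and_iff_right Ω.2, Subtype.forall]
  refine forall₂_congr fun Λ hΛ => imp_congr Iff.rfl ?_
  rw [trace_conjTranspose_mul_eq_zero_iff (mem_su_iff.1 Ω.2).1 (mem_su_iff.1 hΛ).1,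
    (isSymm_hilbertSchmidt n).eq_iff]
  rfl

lemma isCompl_horizontal_ker (ρ : Matrix (Fin n) (Fin n) ℂ) :
    IsCompl (horizontal ρ) (LinearMap.ker (suBracket ρ)) := by
  have hsymm : ((hilbertSchmidt n).restrict (su n)).IsSymm := (isSymm_hilbertSchmidt n).restrict _
  refine (LinearMap.BilinForm.isCompl_orthogonal_of_restrict_nondegenerate hsymm.isRefl ?_).symm
  have h : ∀ A : LinearMap.ker (suBracket ρ), hilbertSchmidt n A.1 A.1 = 0 → A = 0 := fun A hA =>
    Subtype.ext (Subtype.ext (eq_zero_of_hilbertSchmidt_self hA))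
  exact ⟨fun A hA => h A (hA A), fun A hA => h A (hA A)⟩

/-- The inverse of `Ω ↦ ⁅ρ, Ω⁆` on `𝔭_ρ`: the function `lift ρ` as a linear equivalence. -/
def horizontalLift (ρ : Matrix (Fin n) (Fin n) ℂ) : tangentSpace ρ ≃ₗ[ℝ] horizontal ρ :=
  (LinearEquiv.ofEq _ _ (range_suBracket ρ).symm).trans
    ((suBracket ρ).kerComplementEquivRange (isCompl_horizontal_ker ρ)).symm

lemma memP_horizontalLift (ξ : tangentSpace ρ) : MemP ρ (horizontalLift ρ ξ).1.1 :=
  memP_coe_iff.2 (horizontalLift ρ ξ).2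

lemma lie_horizontalLift (ξ : tangentSpace ρ) :
    ⁅ρ, ((horizontalLift ρ ξ).1.1 : Matrix (Fin n) (Fin n) ℂ)⁆ = ξ :=
  congr(($((horizontalLift ρ).symm_apply_apply ξ)).1)

lemma MemP.eq_horizontalLift {Ω : Matrix (Fin n) (Fin n) ℂ} (hΩ : MemP ρ Ω) {ξ : tangentSpace ρ}
    (h : ⁅ρ, Ω⁆ = ξ) : Ω = (horizontalLift ρ ξ).1.1 := by
  have hsymm : (horizontalLift ρ).symm ⟨⟨Ω, hΩ.1⟩, memP_coe_iff.1 hΩ⟩ = ξ := Subtype.ext h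
  rw [← hsymm, LinearEquiv.apply_symm_apply]

lemma coe_horizontalLift (ξ : tangentSpace ρ) :
    ((horizontalLift ρ ξ).1.1 : Matrix (Fin n) (Fin n) ℂ) = lift ρ ξ := by
  have hex : ∃ Ω, MemP ρ Ω ∧ ⁅ρ, Ω⁆ = ξ := ⟨_, memP_horizontalLift ξ, lie_horizontalLift ξ⟩
  rw [lift, dif_pos hex]
  exact (hex.choose_spec.1.eq_horizontalLift hex.choose_spec.2).symm

lemma lie_lift (ξ : tangentSpace ρ) : ⁅ρ, lift ρ ξ⁆ = ξ := by
  rw [← coe_horizontalLift, lie_horizontalLift]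

lemma MemP.lift_lie {Ω : Matrix (Fin n) (Fin n) ℂ} (hΩ : MemP ρ Ω) : lift ρ ⁅ρ, Ω⁆ = Ω :=
  (coe_horizontalLift ⟨_, lie_mem_tangentSpace hΩ.1⟩).symm.trans (hΩ.eq_horizontalLift rfl).symm

/-- The Riemannian metric of the orbit at `ρ`, as a bilinear form on the tangent space. -/
def metricForm (ρ : Matrix (Fin n) (Fin n) ℂ) : LinearMap.BilinForm ℝ (tangentSpace ρ) :=
  (hilbertSchmidt n).comp ((su n).subtype ∘ₗ (horizontal ρ).subtype ∘ₗ (horizontalLift ρ))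
    ((su n).subtype ∘ₗ (horizontal ρ).subtype ∘ₗ (horizontalLift ρ))

lemma metricForm_apply (ξ η : tangentSpace ρ) : metricForm ρ ξ η = metric ρ ξ η := by
  rw [metric, ← coe_horizontalLift, ← coe_horizontalLift]
  rfl

lemma eq_zero_of_metricForm_self {ξ : tangentSpace ρ} (h : metricForm ρ ξ ξ = 0) : ξ = 0 :=
  (horizontalLift ρ).map_eq_zero_iff.1 <|
    Subtype.ext (Subtype.ext (eq_zero_of_hilbertSchmidt_self h))

lemma lie_mem_su (hρ : ρ.IsHermitian) (hθ : θ.IsHermitian) : ⁅ρ, θ⁆ ∈ su n := by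
  refine mem_su_iff.2 ⟨?_, ?_⟩
  · rw [Ring.lie_def, conjTranspose_sub, conjTranspose_mul, conjTranspose_mul, hρ.eq, hθ.eq,
      neg_sub]
  · exact LieAlgebra.matrix_trace_commutator_zero _ _ _ _

lemma trace_lie_mul (A B C : Matrix (Fin n) (Fin n) ℂ) :
    (⁅A, B⁆ * C).trace = (B * ⁅C, A⁆).trace := by
  simp only [Ring.lie_def, sub_mul, mul_sub, trace_sub]
  rw [mul_assoc A B C, trace_mul_comm A, mul_assoc, mul_assoc]

lemma memP_lie (hρ : ρ.IsHermitian) (hθ : θ.IsHermitian) : MemP ρ ⁅ρ, θ⁆ := by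
  have h := lie_mem_su hρ hθ
  refine ⟨h, fun Λ _ hΛ => ?_⟩
  have hΛ' : ⁅Λ, ρ⁆ = 0 := (commute_iff_lie_eq.2 hΛ).symm.lie_eq
  rw [(mem_su_iff.1 h).1, neg_mul, trace_neg, trace_lie_mul, hΛ', mul_zero, trace_zero, neg_zero]

/-- The cost `J` as a continuous linear functional. -/
def costCLM (θ : Matrix (Fin n) (Fin n) ℂ) : Matrix (Fin n) (Fin n) ℂ →L[ℝ] ℝ :=
  (Complex.reLm ∘ₗ traceLinearMap (Fin n) ℝ ℂ ∘ₗ LinearMap.mulRight ℝ θ).toContinuousLinearMap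

lemma hasFDerivAt_cost (θ ρ : Matrix (Fin n) (Fin n) ℂ) :
    HasFDerivAt (cost θ) (costCLM θ) ρ :=
  (costCLM θ).hasFDerivAt

lemma fderiv_cost_apply (η : Matrix (Fin n) (Fin n) ℂ) : fderiv ℝ (cost θ) ρ η = cost θ η :=
  congr($((hasFDerivAt_cost θ ρ).fderiv) η)

theorem isOrbitGradient_lie_lie (hρ : ρ.IsHermitian) (hθ : θ.IsHermitian) :
    IsOrbitGradient θ ρ ⟨⁅ρ, ⁅ρ, θ⁆⁆, lie_mem_tangentSpace (lie_mem_su hρ hθ)⟩ := by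
  intro η hη
  have hskew : ⁅θ, ρ⁆ = -⁅ρ, θ⁆ := by rw [Ring.lie_def, Ring.lie_def, neg_sub]
  calc fderiv ℝ (cost θ) ρ η = cost θ ⁅ρ, lift ρ η⁆ := by
        rw [fderiv_cost_apply, lie_lift ⟨η, hη⟩]
    _ = (⁅ρ, θ⁆ᴴ * lift ρ η).trace.re := by
        rw [cost, trace_lie_mul, trace_mul_comm, hskew, (mem_su_iff.1 (lie_mem_su hρ hθ)).1]
    _ = metric ρ ⁅ρ, ⁅ρ, θ⁆⁆ η := by rw [metric, (memP_lie hρ hθ).lift_lie]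

theorem existsUnique_isOrbitGradient (hρ : ρ.IsHermitian) (hθ : θ.IsHermitian) :
    ∃! G, IsOrbitGradient θ ρ G := by
  refine ⟨_, isOrbitGradient_lie_lie hρ hθ, fun G hG => ?_⟩
  refine sub_eq_zero.1 (eq_zero_of_metricForm_self ?_)
  rw [LinearMap.map_sub₂, metricForm_apply, metricForm_apply, ← hG _ (Subtype.prop _),
    ← isOrbitGradient_lie_lie hρ hθ _ (Subtype.prop _), sub_self]

lemma exists_pow_mul_eq_one {n : ℕ} (hn : n ≠ 0) {d : ℂ} (hd : ‖d‖ = 1) :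
    ∃ c : ℂ, ‖c‖ = 1 ∧ c ^ n * d = 1 := by
  obtain ⟨c, hc⟩ := IsAlgClosed.exists_pow_nat_eq d⁻¹ (Nat.pos_of_ne_zero hn)
  refine ⟨c, (pow_eq_one_iff_of_nonneg (norm_nonneg c) hn).1 ?_, ?_⟩
  · rw [← norm_pow, hc, norm_inv, hd, inv_one]
  · rw [hc, inv_mul_cancel₀ (norm_ne_zero_iff.1 (hd ▸ one_ne_zero))]

lemma exists_smul_mem_specialUnitaryGroup {U : Matrix (Fin n) (Fin n) ℂ}
    (hU : U ∈ unitaryGroup (Fin n) ℂ) :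
    ∃ c : ℂ, ‖c‖ = 1 ∧ c • U ∈ specialUnitaryGroup (Fin n) ℂ := by
  obtain ⟨c, hc, hcU⟩ : ∃ c : ℂ, ‖c‖ = 1 ∧ c ^ n * U.det = 1 := by
    rcases eq_or_ne n 0 with rfl | hn
    · exact ⟨1, by simp⟩
    · exact exists_pow_mul_eq_one hn (CStarRing.norm_of_mem_unitary (det_of_mem_unitary hU))
  refine ⟨c, hc, mem_specialUnitaryGroup_iff.2 ⟨?_, by rwa [det_smul, Fintype.card_fin]⟩⟩
  rw [mem_unitaryGroup_iff, star_smul, smul_mul_smul_comm, mem_unitaryGroup_iff.1 hU,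
    ← starRingEnd_apply, Complex.mul_conj', hc]
  simp

lemma conj_mem_orbit {U : Matrix (Fin n) (Fin n) ℂ} (hU : U ∈ unitaryGroup (Fin n) ℂ)
    (ρ₀ : Matrix (Fin n) (Fin n) ℂ) : U * ρ₀ * Uᴴ ∈ orbit ρ₀ := by
  obtain ⟨c, hc, hcU⟩ := exists_smul_mem_specialUnitaryGroup hU
  refine ⟨c • U, hcU, ?_⟩
  rw [conjTranspose_smul, smul_mul_assoc, smul_mul_smul_comm, ← starRingEnd_apply,
    Complex.mul_conj', hc]
  simp

lemma conj_mem_su {U Ω : Matrix (Fin n) (Fin n) ℂ} (hU : U ∈ unitaryGroup (Fin n) ℂ)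
    (hΩ : Ω ∈ su n) : U * Ω * Uᴴ ∈ su n := by
  refine mem_su_iff.2 ⟨?_, ?_⟩
  · rw [conjTranspose_mul, conjTranspose_mul, conjTranspose_conjTranspose, (mem_su_iff.1 hΩ).1]
    noncomm_ring
  · rw [trace_mul_comm, ← mul_assoc, ← star_eq_conjTranspose, mem_unitaryGroup_iff'.1 hU, one_mul,
      (mem_su_iff.1 hΩ).2]

lemma conj_lie_mem_tangentSpace {U Ω : Matrix (Fin n) (Fin n) ℂ}
    (hU : U ∈ unitaryGroup (Fin n) ℂ) (hΩ : Ω ∈ su n) (ρ : Matrix (Fin n) (Fin n) ℂ) :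
    U * ⁅Ω, ρ⁆ * Uᴴ ∈ tangentSpace (U * ρ * Uᴴ) := by
  have hconj : U * ⁅Ω, ρ⁆ * Uᴴ = ⁅U * ρ * Uᴴ, -(U * Ω * Uᴴ)⁆ := by
    have hΩ' : Uᴴ * (U * Ω * Uᴴ) * U = Ω := by
      calc Uᴴ * (U * Ω * Uᴴ) * U = star U * U * Ω * (star U * U) := by
            rw [star_eq_conjTranspose]
            noncomm_ring
        _ = Ω := by rw [mem_unitaryGroup_iff'.1 hU, one_mul, mul_one]
    have h := mul_lie_mul_of_mul_eq_one (mem_unitaryGroup_iff.1 hU) (U * Ω * Uᴴ) ρ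
    rw [star_eq_conjTranspose, hΩ'] at h
    rw [h, Ring.lie_def, Ring.lie_def]
    noncomm_ring
  rw [hconj]
  exact lie_mem_tangentSpace (neg_mem (conj_mem_su hU hΩ))

end OrbitGeometry

section Duality

lemma intervalIntegrable_control_smul (hT : 0 ≤ T) {F : ℝ → V} (hF : ContinuousOn F (Icc 0 T))
    (v : Control T) : IntervalIntegrable (fun s => v s • F s) volume 0 T :=
  (intervalIntegrable_iff_integrableOn_Icc_of_le hT).2 <|
    integrableOn_bilin (.lsmul ℝ ℝ) (Coefficient.integrableOn v) hF

lemma map_integral_control_smul [CompleteSpace V] [CompleteSpace W] (L : V →L[ℝ] W) (hT : 0 ≤ T)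
    {F : ℝ → V} (hF : ContinuousOn F (Icc 0 T)) (v : Control T) :
    L (∫ s in (0 : ℝ)..T, v s • F s) = ∫ s in (0 : ℝ)..T, v s • L (F s) := by
  rw [← L.intervalIntegral_comp_comm (intervalIntegrable_control_smul hT hF v)]
  simp only [map_smul]

lemma integral_control_smul_mem [CompleteSpace V] {S : Submodule ℝ V}
    (hS : IsClosed (S : Set V)) (hT : 0 ≤ T) {F : ℝ → V} (hF : ContinuousOn F (Icc 0 T))
    (hFS : ∀ s ∈ Icc 0 T, F s ∈ S) (v : Control T) : ∫ s in (0 : ℝ)..T, v s • F s ∈ S := by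
  rw [← Submodule.ker_mkQ S, LinearMap.mem_ker]
  refine (map_integral_control_smul S.mkQL hT hF v).trans ?_
  refine intervalIntegral.integral_zero_ae <| .of_forall fun s hs => ?_
  have hs' : s ∈ Icc 0 T := Ioc_subset_Icc_self (uIoc_of_le hT ▸ hs)
  exact smul_eq_zero_of_right _ ((Submodule.Quotient.mk_eq_zero S).2 (hFS s hs'))

variable {H : Type*} [NormedAddCommGroup H] [InnerProductSpace ℝ H] [CompleteSpace H]

lemma existsUnique_adjoint {W : Type*} [AddCommGroup W] [Module ℝ W] [TopologicalSpace W]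
    [IsTopologicalAddGroup W] [ContinuousSMul ℝ W] [T2Space W] [FiniteDimensional ℝ W]
    (B : LinearMap.BilinForm ℝ W) (D : H →L[ℝ] W) :
    ∃! A : W →ₗ[ℝ] H, ∀ z v, B z (D v) = inner ℝ (A z) v := by
  let precomp : W →ₗ[ℝ] StrongDual ℝ H :=
    { toFun := fun z => (B z).toContinuousLinearMap ∘L D
      map_add' := fun z w => by ext v; simp
      map_smul' := fun c z => by ext v; simp }
  refine ⟨(InnerProductSpace.toDual ℝ H).symm.toLinearEquiv.toLinearMap ∘ₗ precomp,
    fun z v => (InnerProductSpace.toDual_symm_apply (𝕜 := ℝ) (y := precomp z)).symm,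
    fun A hA => LinearMap.ext fun z => ext_inner_right ℝ fun v => ?_⟩
  exact (hA z v).symm.trans
    (InnerProductSpace.toDual_symm_apply (𝕜 := ℝ) (y := precomp z)).symm

lemma hasGradientAt_of_fderiv_apply_eq_inner {f : H → ℝ} {a u : H} (hf : DifferentiableAt ℝ f u)
    (h : ∀ v, fderiv ℝ f u v = inner ℝ a v) : HasGradientAt f a u := by
  rw [hasGradientAt_iff_hasFDerivAt]
  exact hf.hasFDerivAt.congr_fderiv (ContinuousLinearMap.ext h)

lemma ae_eq_of_forall_inner_eq_integral {α : Type*} [MeasurableSpace α] {μ : Measure α} {g : α → ℝ}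
    (hg : MemLp g 2 μ) {a : Lp ℝ 2 μ} (ha : ∀ v : Lp ℝ 2 μ, inner ℝ a v = ∫ s, v s * g s ∂μ) :
    a =ᵐ[μ] g := by
  suffices h : a = hg.toLp g from h ▸ hg.coeFn_toLp
  refine ext_inner_right ℝ fun v => ?_
  rw [ha, L2.inner_def]
  refine integral_congr_ae ?_
  filter_upwards [hg.coeFn_toLp] with s hs
  rw [hs, real_inner_eq_re_inner, RCLike.inner_apply]
  simp

lemma memLp_two_of_continuousOn {g : ℝ → ℝ} (hg : ContinuousOn g (Icc 0 T)) :
    MemLp g 2 (volume.restrict (Icc 0 T)) :=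
  (memLp_two_iff_integrable_sq (hg.aestronglyMeasurable measurableSet_Icc)).2 <|
    (hg.pow 2).integrableOn_compact isCompact_Icc

end Duality

section EndPoint

attribute [local instance] Matrix.frobeniusNormedRing Matrix.frobeniusNormedAlgebra

variable {n : ℕ} {H₀ H₁ ρ₀ θ : Matrix (Fin n) (Fin n) ℂ} {u : Control T}
  {U ρ : ℝ → Matrix (Fin n) (Fin n) ℂ}

lemma isTrajectory_iff (hT : 0 ≤ T) :
    IsTrajectory H₀ H₁ ρ₀ u ρ ↔
      IsPrimitive T ρ (fun s => commutator _ (generator H₀ H₁ u s) (ρ s)) ∧ ρ 0 = ρ₀ :=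
  (isPrimitive_linear_iff (f := ρ) (x₀ := ρ₀) hT
    (commutator (Matrix (Fin n) (Fin n) ℂ)) H₀ H₁ u).symm

lemma isPropagator_iff (hT : 0 ≤ T) :
    IsPropagator H₀ H₁ u U ↔
      IsPrimitive T U (fun s => ContinuousLinearMap.mul ℝ _ (generator H₀ H₁ u s) (U s)) ∧
        U 0 = 1 :=
  (isPrimitive_linear_iff (f := U) (x₀ := 1) hT
    (.mul ℝ (Matrix (Fin n) (Fin n) ℂ)) H₀ H₁ u).symm

theorem exists_isTrajectory_forall_eqOn (hT : 0 ≤ T) (H₀ H₁ ρ₀ : Matrix (Fin n) (Fin n) ℂ)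
    (u : Control T) : ∃ ρ, IsTrajectory H₀ H₁ ρ₀ u ρ ∧
      ∀ ρ', IsTrajectory H₀ H₁ ρ₀ u ρ' → EqOn ρ' ρ (Icc 0 T) := by
  simp only [isTrajectory_iff hT]
  exact exists_isPrimitive_linear_forall_eqOn hT _ _ _

theorem exists_isPropagator_forall_eqOn (hT : 0 ≤ T) (H₀ H₁ : Matrix (Fin n) (Fin n) ℂ)
    (u : Control T) : ∃ U, IsPropagator H₀ H₁ u U ∧
      ∀ U', IsPropagator H₀ H₁ u U' → EqOn U' U (Icc 0 T) := by
  simp only [isPropagator_iff hT]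
  exact exists_isPrimitive_linear_forall_eqOn hT _ _ _

theorem IsTrajectory.endPoint_eq (hT : 0 ≤ T) (hρ : IsTrajectory H₀ H₁ ρ₀ u ρ) :
    endPoint H₀ H₁ ρ₀ u = ρ T := by
  have hex : ∃ ρ, IsTrajectory H₀ H₁ ρ₀ u ρ := ⟨ρ, hρ⟩
  obtain ⟨σ, -, hσ⟩ := exists_isTrajectory_forall_eqOn hT H₀ H₁ ρ₀ u
  have hTmem : T ∈ Icc 0 T := ⟨hT, le_rfl⟩
  rw [endPoint, dif_pos hex, hσ _ hex.choose_spec hTmem, hσ _ hρ hTmem]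

lemma endPoint_eq_solution (hT : 0 ≤ T) (H₀ H₁ ρ₀ : Matrix (Fin n) (Fin n) ℂ) (u : Control T) :
    endPoint H₀ H₁ ρ₀ u =
      solution hT (commutator _) (generator H₀ H₁ u) ρ₀ ⟨T, hT, le_rfl⟩ := by
  rw [((isTrajectory_iff hT).2 (isPrimitive_solution hT _ _ ρ₀)).endPoint_eq hT,
    IccExtend_of_mem _ _ ⟨hT, le_rfl⟩]

lemma hasFDerivAt_endPoint (hT : 0 ≤ T) (H₀ H₁ ρ₀ : Matrix (Fin n) (Fin n) ℂ) (u : Control T) :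
    HasFDerivAt (endPoint H₀ H₁ ρ₀)
      (firstVariation hT (commutator _) H₀ H₁ u ρ₀ ⟨T, hT, le_rfl⟩) u := by
  rw [funext (endPoint_eq_solution hT H₀ H₁ ρ₀)]
  exact hasFDerivAt_solution_generator hT _ H₀ H₁ u ρ₀ _

theorem differentiableAt_endPoint (hT : 0 ≤ T) (H₀ H₁ ρ₀ : Matrix (Fin n) (Fin n) ℂ)
    (u : Control T) : DifferentiableAt ℝ (endPoint H₀ H₁ ρ₀) u :=
  (hasFDerivAt_endPoint hT H₀ H₁ ρ₀ u).differentiableAt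

namespace IsPropagator

theorem fderiv_endPoint_apply (hU : IsPropagator H₀ H₁ u U) (hT : 0 ≤ T) (hH₀ : H₀ᴴ = -H₀)
    (hH₁ : H₁ᴴ = -H₁) (ρ₀ : Matrix (Fin n) (Fin n) ℂ) (v : Control T) :
    fderiv ℝ (endPoint H₀ H₁ ρ₀) u v =
      U T * ⁅∫ s in (0 : ℝ)..T, v s • ((U s)ᴴ * H₁ * U s), ρ₀⁆ * (U T)ᴴ := by
  obtain ⟨hUprim, hU0⟩ := (isPropagator_iff hT).1 hU
  exact congr($((hasFDerivAt_endPoint hT H₀ H₁ ρ₀ u).fderiv) v).trans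
    (firstVariation_commutator_apply hT hH₀ hH₁ hUprim hU0 ρ₀ _ v)

lemma mem_unitaryGroup (hU : IsPropagator H₀ H₁ u U) (hH₀ : H₀ᴴ = -H₀) (hH₁ : H₁ᴴ = -H₁) {t : ℝ}
    (ht : t ∈ Icc 0 T) : U t ∈ unitaryGroup (Fin n) ℂ := by
  obtain ⟨hUprim, hU0⟩ := (isPropagator_iff (ht.1.trans ht.2)).1 hU
  exact mem_unitaryGroup_iff.2
    (propagator_mul_star_self (star_generator hH₀ hH₁ u) hUprim hU0 ht)

lemma endPoint_eq (hU : IsPropagator H₀ H₁ u U) (hT : 0 ≤ T) (hH₀ : H₀ᴴ = -H₀)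
    (hH₁ : H₁ᴴ = -H₁) (ρ₀ : Matrix (Fin n) (Fin n) ℂ) :
    endPoint H₀ H₁ ρ₀ u = U T * ρ₀ * (U T)ᴴ := by
  obtain ⟨hUprim, hU0⟩ := (isPropagator_iff hT).1 hU
  have htraj := isPrimitive_conj_const (star_generator hH₀ hH₁ u) hUprim ρ₀
  exact ((isTrajectory_iff hT).2 ⟨htraj, by simp [hU0]⟩).endPoint_eq hT

lemma continuousOn_conj (hU : IsPropagator H₀ H₁ u U) (A : Matrix (Fin n) (Fin n) ℂ) :
    ContinuousOn (fun s => (U s)ᴴ * A * U s) (Icc 0 T) :=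
  (hU.1.star.mul continuousOn_const).mul hU.1

end IsPropagator

end EndPoint

section SwitchingFunction

attribute [local instance] Matrix.frobeniusNormedRing Matrix.frobeniusNormedAlgebra

variable {n : ℕ} {H₀ H₁ ρ₀ θ : Matrix (Fin n) (Fin n) ℂ} {u : Control T}
  {U : ℝ → Matrix (Fin n) (Fin n) ℂ}

/-- The switching function of the control problem: the first variation of the cost at the end point
produced by an impulse of the control at time `t`, in terms of the propagator `U`. -/
def switchingFunction (θ H₁ ρ₀ : Matrix (Fin n) (Fin n) ℂ) (T : ℝ)
    (U : ℝ → Matrix (Fin n) (Fin n) ℂ) (t : ℝ) : ℝ :=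
  cost ((U T)ᴴ * θ * U T) ⁅(U t)ᴴ * H₁ * U t, ρ₀⁆

lemma cost_conj (θ U X : Matrix (Fin n) (Fin n) ℂ) : cost θ (U * X * Uᴴ) = cost (Uᴴ * θ * U) X := by
  rw [cost, cost, mul_assoc, mul_assoc, trace_mul_comm, mul_assoc, mul_assoc]

lemma switchingFunction_eq_trace (hH₁ : H₁ᴴ = -H₁) (hρ₀ : ρ₀.IsHermitian) (hθ : θ.IsHermitian)
    (t : ℝ) :
    (switchingFunction θ H₁ ρ₀ T U t : ℂ) =
      -(⁅ρ₀, (U T)ᴴ * θ * U T⁆ᴴ * ((U t)ᴴ * H₁ * U t)).trace := by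
  have hskew := (mem_su_iff.1 (lie_mem_su hρ₀ (isHermitian_conjTranspose_mul_mul (U T) hθ))).1
  have hH : ((U t)ᴴ * H₁ * U t)ᴴ = -((U t)ᴴ * H₁ * U t) := by
    simp only [conjTranspose_mul, conjTranspose_conjTranspose, hH₁, neg_mul, mul_neg, mul_assoc]
  have him : (⁅ρ₀, (U T)ᴴ * θ * U T⁆ * ((U t)ᴴ * H₁ * U t)).trace.im = 0 :=
    trace_mul_im_eq_zero hskew hH
  rw [hskew, neg_mul, trace_neg, neg_neg, switchingFunction, cost, trace_mul_comm, ← trace_lie_mul]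
  exact Complex.conj_eq_iff_re.1 (Complex.conj_eq_iff_im.2 him)

lemma continuous_cost (θ : Matrix (Fin n) (Fin n) ℂ) : Continuous (cost θ) :=
  Complex.continuous_re.comp (continuous_id.mul continuous_const).matrix_trace

namespace IsPropagator

lemma continuousOn_switchingFunction (hU : IsPropagator H₀ H₁ u U)
    (θ ρ₀ : Matrix (Fin n) (Fin n) ℂ) :
    ContinuousOn (switchingFunction θ H₁ ρ₀ T U) (Icc 0 T) :=
  (continuous_cost _).comp_continuousOn
    (((hU.continuousOn_conj H₁).mul continuousOn_const).sub
      (continuousOn_const.mul (hU.continuousOn_conj H₁)))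

lemma integral_conj_mem_su (hU : IsPropagator H₀ H₁ u U) (hT : 0 ≤ T) (hH₀ : H₀ᴴ = -H₀)
    (hH₁ : H₁ ∈ su n) (v : Control T) :
    ∫ s in (0 : ℝ)..T, v s • ((U s)ᴴ * H₁ * U s) ∈ su n := by
  refine integral_control_smul_mem (su n).closed_of_finiteDimensional hT
    (hU.continuousOn_conj H₁) (fun s hs => ?_) v
  have hmem := conj_mem_su (Unitary.star_mem (hU.mem_unitaryGroup hH₀ (mem_su_iff.1 hH₁).1 hs)) hH₁
  rwa [star_eq_conjTranspose, conjTranspose_conjTranspose] at hmem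

theorem fderiv_endPoint_mem_tangentSpace (hU : IsPropagator H₀ H₁ u U) (hT : 0 ≤ T)
    (hH₀ : H₀ᴴ = -H₀) (hH₁ : H₁ ∈ su n) (ρ₀ : Matrix (Fin n) (Fin n) ℂ) (v : Control T) :
    fderiv ℝ (endPoint H₀ H₁ ρ₀) u v ∈ tangentSpace (endPoint H₀ H₁ ρ₀ u) := by
  have hH₁' := (mem_su_iff.1 hH₁).1
  rw [hU.fderiv_endPoint_apply hT hH₀ hH₁', hU.endPoint_eq hT hH₀ hH₁']
  exact conj_lie_mem_tangentSpace (hU.mem_unitaryGroup hH₀ hH₁' ⟨hT, le_rfl⟩)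
    (hU.integral_conj_mem_su hT hH₀ hH₁ v) ρ₀

theorem endPoint_mem_orbit (hU : IsPropagator H₀ H₁ u U) (hT : 0 ≤ T) (hH₀ : H₀ᴴ = -H₀)
    (hH₁ : H₁ᴴ = -H₁) (ρ₀ : Matrix (Fin n) (Fin n) ℂ) :
    endPoint H₀ H₁ ρ₀ u ∈ orbit ρ₀ := by
  rw [hU.endPoint_eq hT hH₀ hH₁]
  exact conj_mem_orbit (hU.mem_unitaryGroup hH₀ hH₁ ⟨hT, le_rfl⟩) ρ₀

theorem isHermitian_endPoint (hU : IsPropagator H₀ H₁ u U) (hT : 0 ≤ T) (hH₀ : H₀ᴴ = -H₀)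
    (hH₁ : H₁ᴴ = -H₁) (hρ₀ : ρ₀.IsHermitian) : (endPoint H₀ H₁ ρ₀ u).IsHermitian := by
  rw [hU.endPoint_eq hT hH₀ hH₁]
  exact isHermitian_mul_mul_conjTranspose (U T) hρ₀

lemma cost_fderiv_endPoint (hU : IsPropagator H₀ H₁ u U) (hT : 0 ≤ T) (hH₀ : H₀ᴴ = -H₀)
    (hH₁ : H₁ᴴ = -H₁) (θ ρ₀ : Matrix (Fin n) (Fin n) ℂ) (v : Control T) :
    cost θ (fderiv ℝ (endPoint H₀ H₁ ρ₀) u v) =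
      ∫ s in Icc 0 T, v s * switchingFunction θ H₁ ρ₀ T U s := by
  rw [hU.fderiv_endPoint_apply hT hH₀ hH₁, cost_conj, integral_Icc_eq_integral_Ioc,
    ← intervalIntegral.integral_of_le hT]
  let costLie : Matrix (Fin n) (Fin n) ℂ →ₗ[ℝ] ℝ :=
    costCLM ((U T)ᴴ * θ * U T) ∘ₗ (LinearMap.mulRight ℝ ρ₀ - LinearMap.mulLeft ℝ ρ₀)
  exact map_integral_control_smul costLie.toContinuousLinearMap hT (hU.continuousOn_conj H₁) v

theorem ae_eq_switchingFunction (hU : IsPropagator H₀ H₁ u U) (hT : 0 ≤ T) (hH₀ : H₀ᴴ = -H₀)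
    (hH₁ : H₁ᴴ = -H₁) {a : Control T}
    (ha : ∀ v, cost θ (fderiv ℝ (endPoint H₀ H₁ ρ₀) u v) = inner ℝ a v) :
    a =ᵐ[volume.restrict (Icc 0 T)] switchingFunction θ H₁ ρ₀ T U :=
  ae_eq_of_forall_inner_eq_integral
    (memLp_two_of_continuousOn (hU.continuousOn_switchingFunction θ ρ₀))
    fun v => (ha v).symm.trans (hU.cost_fderiv_endPoint hT hH₀ hH₁ θ ρ₀ v)

end IsPropagator

theorem existsUnique_isAdjointDiff
    (htan : ∀ v : Control T,
      fderiv ℝ (endPoint H₀ H₁ ρ₀) u v ∈ tangentSpace (endPoint H₀ H₁ ρ₀ u)) :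
    ∃! A, IsAdjointDiff H₀ H₁ ρ₀ u A := by
  have h := existsUnique_adjoint (metricForm (endPoint H₀ H₁ ρ₀ u))
    ((fderiv ℝ (endPoint H₀ H₁ ρ₀) u).codRestrict _ htan)
  simp only [metricForm_apply] at h
  exact h

theorem IsAdjointDiff.cost_fderiv_eq_inner
    {A : tangentSpace (endPoint H₀ H₁ ρ₀ u) →ₗ[ℝ] Control T}
    {G : tangentSpace (endPoint H₀ H₁ ρ₀ u)} (hA : IsAdjointDiff H₀ H₁ ρ₀ u A)
    (hG : IsOrbitGradient θ (endPoint H₀ H₁ ρ₀ u) G)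
    (htan : ∀ v : Control T,
      fderiv ℝ (endPoint H₀ H₁ ρ₀) u v ∈ tangentSpace (endPoint H₀ H₁ ρ₀ u)) (v : Control T) :
    cost θ (fderiv ℝ (endPoint H₀ H₁ ρ₀) u v) = inner ℝ (A G) v := by
  rw [← hA G v, ← hG _ (htan v), fderiv_cost_apply]

theorem hasGradientAt_cost_endPoint (hT : 0 ≤ T) {a : Control T}
    (ha : ∀ v, cost θ (fderiv ℝ (endPoint H₀ H₁ ρ₀) u v) = inner ℝ a v) :
    HasGradientAt (fun w : Control T => cost θ (endPoint H₀ H₁ ρ₀ w)) a u := by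
  have h := (hasFDerivAt_cost θ _).comp u (differentiableAt_endPoint hT H₀ H₁ ρ₀ u).hasFDerivAt
  refine hasGradientAt_of_fderiv_apply_eq_inner h.differentiableAt fun v => ?_
  rw [← ha v]
  exact congr($(h.fderiv) v)

end SwitchingFunction

end

end QuantumControl

theorem mainTheorem7 (n : ℕ) (T : ℝ) (hT : 0 < T)
    (H₀ H₁ ρ₀ θ : Matrix (Fin n) (Fin n) ℂ)
    (hH₀ : H₀ ∈ su n) (hH₁ : H₁ ∈ su n)
    (hρ₀ : ρ₀.IsHermitian) (hθ : θ.IsHermitian) :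
    -- the two evolution equations are well posed
    (∀ u : Control T, ∃ ρ, IsTrajectory H₀ H₁ ρ₀ u ρ ∧
      ∀ ρ', IsTrajectory H₀ H₁ ρ₀ u ρ' → Set.EqOn ρ' ρ (Set.Icc 0 T)) ∧
    (∀ u : Control T, ∃ U, IsPropagator H₀ H₁ u U ∧
      ∀ U', IsPropagator H₀ H₁ u U' → Set.EqOn U' U (Set.Icc 0 T)) ∧
    ∀ u : Control T,
      -- the end-point map takes values in the orbit, is differentiable,
      -- and its differential takes values in the tangent space of the orbit
      endPoint H₀ H₁ ρ₀ u ∈ orbit ρ₀ ∧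
      DifferentiableAt ℝ (endPoint (T := T) H₀ H₁ ρ₀) u ∧
      (∀ v : Control T, fderiv ℝ (endPoint H₀ H₁ ρ₀) u v ∈
        tangentSpace (endPoint H₀ H₁ ρ₀ u)) ∧
      -- `A` is the adjoint of the differential, `G` is the gradient of `J` at the end-point
      ∃ (A : tangentSpace (endPoint H₀ H₁ ρ₀ u) →ₗ[ℝ] Control T)
        (G : tangentSpace (endPoint H₀ H₁ ρ₀ u)),
        IsAdjointDiff H₀ H₁ ρ₀ u A ∧
        (∀ A', IsAdjointDiff H₀ H₁ ρ₀ u A' → A' = A) ∧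
        IsOrbitGradient θ (endPoint H₀ H₁ ρ₀ u) G ∧
        (∀ G', IsOrbitGradient θ (endPoint H₀ H₁ ρ₀ u) G' → G' = G) ∧
        HasGradientAt (fun w : Control T => cost θ (endPoint H₀ H₁ ρ₀ w)) (A G) u ∧
        ∀ U, IsPropagator H₀ H₁ u U →
          ∀ᵐ t ∂(volume.restrict (Set.Icc (0 : ℝ) T)),
            (((A G : Control T) t : ℝ) : ℂ) =
              -(⁅ρ₀, (U T)ᴴ * θ * U T⁆ᴴ * ((U t)ᴴ * H₁ * U t)).trace := by
  have hH₀' := (mem_su_iff.1 hH₀).1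
  have hH₁' := (mem_su_iff.1 hH₁).1
  have hprop : ∀ u : Control T, _ := exists_isPropagator_forall_eqOn hT.le H₀ H₁
  refine ⟨exists_isTrajectory_forall_eqOn hT.le H₀ H₁ ρ₀, hprop, fun u => ?_⟩
  obtain ⟨V, hV, -⟩ := hprop u
  have htan := hV.fderiv_endPoint_mem_tangentSpace hT.le hH₀' hH₁ ρ₀
  obtain ⟨A, hA, hA_unique⟩ := existsUnique_isAdjointDiff htan
  obtain ⟨G, hG, hG_unique⟩ :=
    existsUnique_isOrbitGradient (hV.isHermitian_endPoint hT.le hH₀' hH₁' hρ₀) hθ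
  have hAG := hA.cost_fderiv_eq_inner hG htan
  refine ⟨hV.endPoint_mem_orbit hT.le hH₀' hH₁' ρ₀, differentiableAt_endPoint hT.le H₀ H₁ ρ₀ u,
    htan, A, G, hA, hA_unique, hG, hG_unique, hasGradientAt_cost_endPoint hT.le hAG,
    fun U hU => ?_⟩
  filter_upwards [hU.ae_eq_switchingFunction hT.le hH₀' hH₁' hAG] with t ht
  rw [ht, switchingFunction_eq_trace hH₁' hρ₀ hθ]
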